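/- Let $q$ be a prime, let $0<i<d-1$ be integers, let $\beta\ge 0$ and put $p=1-e^{-\beta}\in[0,1)$. Regard $\mathbb Z^d$ as a cubical complex with its standard unit cubes, and for $n\ge 0$ let $\Lambda_n$ denote the finite subcomplex of all cubes whose vertices all lie in $[-n,n]^d$. All chains, cochains and homology groups have coefficients in $\mathbb F_q=\mathbb Z/q\mathbb Z$; write $X^k$ for the set of $k$-dimensional cubes ("$k$-plaquettes") of a complex $X$. **Potts lattice gauge theory.** For a finite cubical complex $X$, $(i-1)$-dimensional $q$-state Potts lattice gauge theory on $X$ is the probability measure on cochains $f\in C^{i-1}(X;\mathbb F_q)$ given by $$\nu_{X}(f)\ \propto\ e^{-\beta H(f)},\qquad H(f)=-\#\{\sigma\in X^i:\ f(\partial\sigma)=0\}.$$ **Plaquette random-cluster model.** The $i$-dimensional plaquette random-cluster model on $X$ is the random complex $P$ consisting of the $(i-1)$-skeleton of $X$ and a random set of $|P|$ many "open" $i$-plaquettes of $X$, with $$\mu_{X}(P)\ \propto\ p^{|P|}(1-p)^{|X^i|-|P|}\,q^{\mathbf b_{i-1}(P)},\qquad \mathbf b_{i-1}(P)=\dim_{\mathbb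 F_q}H_{i-1}(P;\mathbb F_q).$$ Regard $\nu_{\Lambda_n}$ as the law of a random $(i-1)$-cochain of $\mathbb Z^d$ that vanishes outside $\Lambda_n$, and $\mu_{\Lambda_n}$ as the law of a random open/closed configuration of the $i$-plaquettes of $\mathbb Z^d$ in which the plaquettes outside $\Lambda_n$ are closed. **Theorem.** The weak limits (free boundary conditions) $$\nu^{\mathbf f}=\lim_{n\to\infty}\nu_{\Lambda_n},\qquad \mu_{\mathbb Z^d}=\lim_{n\to\infty}\mu_{\Lambda_n}$$ exist. For a cycle $\gamma\in Z_{i-1}(\mathbb Z^d;\mathbb F_q)$ let $W_\gamma(f)=e^{2\pi\sqrt{-1}\,f(\gamma)/q}$ be the generalized Wilson loop variable, and let $V_\gamma$ be the event that $\gamma$ is null-homologous over $\mathbb F_q$ in the random complex $P$ formed by the $(i-1)$-skeleton of $\mathbb Z^d$ and the open $i$-plaquettes, i.e. that $\gamma=\partial\rho$ for some $\rho\in C_i(P;\mathbb F_q)$. Then for every $(i-1)$-cycle $\gamma\in Z_{i-1}(\mathbb Z^d;\mathbb F_q)$, $W_\gamma$ is $\nu^{\mathbf f}$-integrable, $V_\gamma$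 is measurable, and $$\mathbb E_{\nu^{\mathbf f}}(W_\gamma)=\mu_{\mathbb Z^d}(V_\gamma).$$ -/

import Mathlib

set_option maxSynthPendingDepth 3

open MeasureTheory Filter Topology

namespace PlaquetteModel

/-! ### The cubical complex `ℤ^d` -/

/-- A cube of the integer lattice complex `ℤ^d`: the product over the coordinates `j` of
`[base j, base j + 1]` if `j ∈ dirs`, and of the point `{base j}` otherwise. -/
@[ext]
structure Cube (d : ℕ) where
  /-- the lexicographically smallest vertex -/
  base : Fin d → ℤ
  /-- the coordinate directions in which the cube has side length one -/
  dirs : Finset (Fin d)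
deriving DecidableEq

variable {d : ℕ}

instance : Countable (Cube d) :=
  Function.Injective.countable (f := fun c : Cube d => (c.base, c.dirs)) (by
    intro a b h
    simp only [Prod.mk.injEq] at h
    exact Cube.ext h.1 h.2)

namespace Cube

/-- The dimension of a cube. -/
def dim (c : Cube d) : ℕ := c.dirs.card

/-- The vertices of a cube. -/
def vertices (c : Cube d) : Finset (Fin d → ℤ) :=
  c.dirs.powerset.image fun T j => c.base j + if j ∈ T then 1 else 0

/-- The face of a cube obtained by replacing its `j`-th side by the left endpoint of that side. -/
def lowerFace (c : Cube d) (j : Fin d) : Cube d := ⟨c.base, c.dirs.erase j⟩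

/-- The face of a cube obtained by replacing its `j`-th side by the right endpoint of that side. -/
def upperFace (c : Cube d) (j : Fin d) : Cube d :=
  ⟨Function.update c.base j (c.base j + 1), c.dirs.erase j⟩

end Cube

/-- The `k`-dimensional plaquettes of `ℤ^d`. -/
abbrev Plaquette (d k : ℕ) := {c : Cube d // c.dim = k}

/-! ### Cubical homology -/

section Homology

variable (F : Type*) [CommRing F]

/-- The boundary of a cube. If the directions of `c` are `k₁ < k₂ < ⋯`, then the pair of faces
orthogonal to `k_l` has the sign `(-1)^(l-1)`. -/
noncomputable def cubeBoundary (c : Cube d) : Cube d →₀ F :=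
  ∑ j ∈ c.dirs, (-1 : F) ^ (c.dirs.filter (· < j)).card •
    (Finsupp.single (c.upperFace j) 1 - Finsupp.single (c.lowerFace j) 1)

/-- The boundary operator on the chains of `ℤ^d` (finite linear combinations of cubes) with
coefficients in `F`. It vanishes on vertices. -/
noncomputable def boundary : (Cube d →₀ F) →ₗ[F] (Cube d →₀ F) :=
  Finsupp.linearCombination F (cubeBoundary F)

/-- The `k`-chains `C_k(X; F)` of a subcomplex `X` of `ℤ^d`, as a subspace of the space of all
chains of `ℤ^d`. Here and below a subcomplex is given by the set of its cubes. -/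
def chains (X : Set (Cube d)) (k : ℕ) : Submodule F (Cube d →₀ F) :=
  Finsupp.supported F F {c | c ∈ X ∧ c.dim = k}

/-- The `k`-cycles `Z_k(X; F)`. -/
noncomputable def cycles (X : Set (Cube d)) (k : ℕ) : Submodule F (Cube d →₀ F) :=
  chains F X k ⊓ LinearMap.ker (boundary F)

/-- The `k`-boundaries `B_k(X; F)`. -/
noncomputable def boundaries (X : Set (Cube d)) (k : ℕ) : Submodule F (Cube d →₀ F) :=
  (chains F X (k + 1)).map (boundary F)

theorem boundary_cubeBoundary (c : Cube d) : boundary F (cubeBoundary F c) = 0 := by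
  classical
  have hcard : ∀ {j l : Fin d}, j ∈ c.dirs → l ∈ c.dirs → j < l →
      (-1 : F) ^ (c.dirs.filter (· < j)).card * (-1) ^ ((c.dirs.erase j).filter (· < l)).card +
      (-1) ^ (c.dirs.filter (· < l)).card * (-1) ^ ((c.dirs.erase l).filter (· < j)).card = 0 := by
    intro j l hj hl hjl
    have h1 : (c.dirs.erase l).filter (· < j) = c.dirs.filter (· < j) := by
      ext m
      simp only [Finset.mem_filter, Finset.mem_erase]
      constructor
      · tauto
      · rintro ⟨h, h'⟩
        exact ⟨⟨(h'.trans hjl).ne, h⟩, h'⟩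
    have h2 : ((c.dirs.erase j).filter (· < l)).card + 1 = (c.dirs.filter (· < l)).card := by
      rw [Finset.filter_erase, Finset.card_erase_add_one]
      simp [hj, hjl]
    rw [h1, ← h2, pow_succ]
    ring
  let T : Fin d → Fin d → (Cube d →₀ F) := fun j l =>
    (Finsupp.single ((c.upperFace j).upperFace l) 1 -
      Finsupp.single ((c.upperFace j).lowerFace l) 1) -
    (Finsupp.single ((c.lowerFace j).upperFace l) 1 -
      Finsupp.single ((c.lowerFace j).lowerFace l) 1)
  have hT : ∀ {j l : Fin d}, j ≠ l → T j l = T l j := by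
    intro j l hjl
    simp only [T, Cube.upperFace, Cube.lowerFace, Finset.erase_right_comm (a := j) (b := l),
      Function.update_of_ne hjl.symm, Function.update_of_ne hjl, Function.update_comm hjl]
    abel
  have key : boundary F (cubeBoundary F c) = ∑ j ∈ c.dirs, ∑ l ∈ c.dirs.erase j,
      ((-1 : F) ^ (c.dirs.filter (· < j)).card *
        (-1) ^ ((c.dirs.erase j).filter (· < l)).card) • T j l := by
    rw [cubeBoundary, map_sum]
    refine Finset.sum_congr rfl fun j _ => ?_
    rw [map_smul, map_sub]
    simp only [boundary, Finsupp.linearCombination_single, one_smul]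
    have hu : (c.upperFace j).dirs = c.dirs.erase j := rfl
    have hl : (c.lowerFace j).dirs = c.dirs.erase j := rfl
    simp only [cubeBoundary, hu, hl, ← Finset.sum_sub_distrib, Finset.smul_sum]
    refine Finset.sum_congr rfl fun l _ => ?_
    rw [mul_smul, ← smul_sub]
  rw [key, Finset.sum_sigma']
  refine Finset.sum_involution (fun x _ => ⟨x.2, x.1⟩) ?_ ?_ ?_ ?_
  · rintro ⟨j, l⟩ h
    simp only [Finset.mem_sigma, Finset.mem_erase] at h
    obtain ⟨hj, hlj, hl⟩ := h
    dsimp only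
    rw [hT hlj, ← add_smul]
    rcases lt_or_gt_of_ne hlj with h | h
    · rw [add_comm, hcard hl hj h, zero_smul]
    · rw [hcard hj hl h, zero_smul]
  · rintro ⟨j, l⟩ h _ h'
    simp only [Finset.mem_sigma, Finset.mem_erase] at h
    simp only [Sigma.mk.injEq] at h'
    exact h.2.1 h'.1
  · rintro ⟨j, l⟩ h
    simp only [Finset.mem_sigma, Finset.mem_erase] at h ⊢
    exact ⟨h.2.2, h.2.1.symm, h.1⟩
  · rintro ⟨j, l⟩ _
    rfl

/-- The square of the boundary operator is zero. -/
theorem boundary_boundary (γ : Cube d →₀ F) : boundary F (boundary F γ) = 0 := by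
  induction γ using Finsupp.induction_linear with
  | zero => simp
  | add f g hf hg => simp [hf, hg]
  | single c a =>
    have : boundary F (Finsupp.single c a) = a • cubeBoundary F c := by
      simp [boundary]
    rw [this, map_smul, boundary_cubeBoundary, smul_zero]

/-- The homology `H_k(X; F) = Z_k(X; F) / B_k(X; F)`. -/
abbrev Homology (X : Set (Cube d)) (k : ℕ) : Type _ :=
  cycles F X k ⧸ (boundaries F X k).submoduleOf (cycles F X k)

/-- The Betti number `b_k(X; F) = dim H_k(X; F)`. -/
noncomputable def betti (X : Set (Cube d)) (k : ℕ) : ℕ := Module.finrank F (Homology F X k)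

/-- The value `f(γ)` of a `k`-cochain `f` on a chain `γ`: the linear extension of `f` (which is zero
on the components of `γ` of degree other than `k`). A cochain is given by its values on the
plaquettes with their standard orientation. -/
noncomputable def evalChain {k : ℕ} (f : Plaquette d k → F) (γ : Cube d →₀ F) : F :=
  Finsupp.linearCombination F f (γ.subtypeDomain fun c => c.dim = k)

/-- The coboundary `δf(σ) = f(∂σ)`. -/
noncomputable def coboundary {k : ℕ} (f : Plaquette d k → F) (σ : Cube d) : F :=
  evalChain F f (cubeBoundary F σ)

end Homology

/-! ### Finite subcomplexes and boxes -/

/-- The set `X^k` of `k`-plaquettes of a finite complex `X`. -/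
def cells (X : Finset (Cube d)) (k : ℕ) : Finset (Cube d) := X.filter fun c => c.dim = k

/-- Extend a function on the `k`-plaquettes of `X` to all `k`-plaquettes of `ℤ^d` by a constant. -/
def extend {α : Type*} (X : Finset (Cube d)) (k : ℕ) (a : α) (f : cells X k → α) :
    Plaquette d k → α :=
  fun σ => if h : σ.1 ∈ cells X k then f ⟨σ.1, h⟩ else a

/-- The vertex set `Λ_n = [-n, n]^d ∩ ℤ^d`. -/
noncomputable def boxVertices (d n : ℕ) : Finset (Fin d → ℤ) :=
  Finset.Icc (fun _ => -(n : ℤ)) (fun _ => (n : ℤ))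

/-- The subcomplex of `ℤ^d` induced by `Λ_n`: all cubes whose vertices all belong to `Λ_n`. -/
noncomputable def box (d n : ℕ) : Finset (Cube d) :=
  ((boxVertices d n ×ˢ (Finset.univ : Finset (Finset (Fin d)))).image
    fun x => (⟨x.1, x.2⟩ : Cube d)).filter fun c => c.vertices ⊆ boxVertices d n

theorem mem_box {n : ℕ} {c : Cube d} : c ∈ box d n ↔ c.vertices ⊆ boxVertices d n := by
  simp only [box, Finset.mem_filter, Finset.mem_image, Finset.mem_product, Finset.mem_univ,
    and_true, and_iff_right_iff_imp]
  intro h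
  refine ⟨(c.base, c.dirs), h ?_, rfl⟩
  exact Finset.mem_image.2 ⟨∅, by simp, by simp⟩

/-! ### The plaquette random-cluster model -/

/-- The random complex `P(ω)` in `X` attached to a configuration `ω` (`true` for an open plaquette,
`false` for a closed one): the `(i-1)`-skeleton of `X` together with the open `i`-plaquettes
of `X`. -/
def percolationComplex (X : Set (Cube d)) (i : ℕ) (ω : Plaquette d i → Bool) : Set (Cube d) :=
  {c | c ∈ X ∧ c.dim < i} ∪ {c | c ∈ X ∧ ∃ h : c.dim = i, ω ⟨c, h⟩ = true}

/-- The weight `p^|P| (1-p)^(|X^i|-|P|) q^(b_{i-1}(P; F))` of the configuration `ω` on the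
`i`-plaquettes of the finite complex `X`, where `P = P(ω)`. -/
noncomputable def rcWeight (F : Type*) [Field F] (X : Finset (Cube d)) (i : ℕ) (p q : ℝ)
    (ω : cells X i → Bool) : ℝ :=
  p ^ (Finset.univ.filter fun σ => ω σ = true).card *
    (1 - p) ^ ((cells X i).card - (Finset.univ.filter fun σ => ω σ = true).card) *
    q ^ betti F (percolationComplex (X : Set (Cube d)) i (extend X i false ω)) (i - 1)

theorem exists_rcWeight_pos (F : Type*) [Field F] (X : Finset (Cube d)) (i : ℕ)
    (p : unitInterval) {q : ℝ} (hq : 0 < q) : ∃ ω, 0 < rcWeight F X i p q ω := by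
  rcases eq_or_lt_of_le p.2.2 with h | h
  · refine ⟨fun _ => true, ?_⟩
    simp [rcWeight, h, hq]
  · refine ⟨fun _ => false, ?_⟩
    have : 0 < 1 - (p : ℝ) := by linarith
    simp only [rcWeight, Bool.false_eq_true, Finset.filter_false, Finset.card_empty, pow_zero]
    positivity

/-- The probability mass function on a finite type proportional to the weight `w`. -/
noncomputable def normalizedPMF {α : Type*} [Finite α] (w : α → ℝ) (hw : ∃ a, 0 < w a) : PMF α :=
  PMF.normalize (fun a => ENNReal.ofReal (w a))
    (by
      obtain ⟨a, ha⟩ := hw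
      intro h
      have := ENNReal.tsum_eq_zero.1 h a
      rw [ENNReal.ofReal_eq_zero] at this
      linarith)
    (by
      have := Fintype.ofFinite α
      rw [tsum_fintype]
      exact ENNReal.sum_ne_top.2 fun _ _ => ENNReal.ofReal_ne_top)

/-- The `i`-dimensional plaquette random-cluster model with parameters `p`, `q` and coefficient
field `F = ℤ/q` on the finite complex `X`, as a random configuration of the `i`-plaquettes of `ℤ^d`
in which all plaquettes outside of `X` are closed. -/
noncomputable def randomCluster (X : Finset (Cube d)) (i q : ℕ) [hq : Fact q.Prime]
    (p : unitInterval) : ProbabilityMeasure (Plaquette d i → Bool) :=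
  ⟨((normalizedPMF (rcWeight (ZMod q) X i p q)
      (exists_rcWeight_pos (ZMod q) X i p (Nat.cast_pos.2 hq.out.pos))).map
        (extend X i false)).toMeasure, inferInstance⟩

/-- The infinite volume plaquette random-cluster model on `ℤ^d` with free boundary conditions: the
weak limit of the models on the boxes `Λ_n`. -/
noncomputable def randomClusterZd (d i q : ℕ) [Fact q.Prime] (p : unitInterval) :
    ProbabilityMeasure (Plaquette d i → Bool) :=
  limUnder atTop fun n => randomCluster (box d n) i q p

/-! ### Potts lattice gauge theory -/

/-- The Hamiltonian `H(f) = -∑_σ K(δf(σ), 0)` of `(i-1)`-dimensional `q`-state Potts lattice gauge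
theory on the finite complex `X`, where `σ` runs over the `i`-plaquettes of `X`. -/
noncomputable def hamiltonian (X : Finset (Cube d)) (i q : ℕ) (f : cells X (i - 1) → ZMod q) : ℝ :=
  -∑ σ ∈ cells X i, if coboundary (ZMod q) (extend X (i - 1) 0 f) σ = 0 then 1 else 0

/-- The `(i-1)`-dimensional `q`-state Potts lattice gauge theory on the finite complex `X`, with
inverse temperature `β`: the weight of `f` is `exp(-β H(f))`. It is regarded as a random cochain
of `ℤ^d` that is zero outside of `X`. -/
noncomputable def potts (X : Finset (Cube d)) (i q : ℕ) [Fact q.Prime] (β : ℝ) :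
    ProbabilityMeasure (Plaquette d (i - 1) → ZMod q) :=
  ⟨((normalizedPMF (fun f => Real.exp (-β * hamiltonian X i q f)) ⟨0, Real.exp_pos _⟩).map
      (extend X (i - 1) 0)).toMeasure, inferInstance⟩

/-- The infinite volume Potts lattice gauge theory on `ℤ^d` with free boundary conditions: the weak
limit of the theories on the boxes `Λ_n`. -/
noncomputable def pottsZd (d i q : ℕ) [Fact q.Prime] (β : ℝ) :
    ProbabilityMeasure (Plaquette d (i - 1) → ZMod q) :=
  limUnder atTop fun n => potts (box d n) i q β

/-- The generalized Wilson loop variable `W_γ(f) = f(γ)^ℂ`, where an element `g` of `ℤ/q` is sent to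
the root of unity `exp(2πig/q)`. -/
noncomputable def wilsonLoop {k q : ℕ} [Fact q.Prime] (γ : Cube d →₀ ZMod q)
    (f : Plaquette d k → ZMod q) : ℂ :=
  ZMod.stdAddChar (evalChain (ZMod q) f γ)

/-- The event `V_γ` that the `(i-1)`-chain `γ` is null-homologous in `P(ω)`, that is, that `γ` is
the boundary of an `i`-chain of `P(ω)` with coefficients in `ℤ/q`. -/
def nullHomologous {q : ℕ} (i : ℕ) (γ : Cube d →₀ ZMod q) : Set (Plaquette d i → Bool) :=
  {ω | γ ∈ boundaries (ZMod q) (percolationComplex Set.univ i ω) (i - 1)}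

end PlaquetteModel

/-!
Both models have the same combinatorial core. Fix `t = e^β - 1 = p / (1 - p)` and give a finite set
`S` of `i`-plaquettes the weight `t^|S| q^(-rank S)`, where `rank S` is the dimension of the span of
the boundaries `∂σ`, `σ ∈ S` (`plaquetteWeight`).

* Since the percolation complex contains the whole `(i-1)`-skeleton, its cycle space in degree
  `i - 1` is fixed and its Betti number is a constant minus `rank S`. So the random-cluster model on
  a box is the normalized `plaquetteWeight` on the subsets of the box (`integral_randomCluster`).
* Expanding the Boltzmann weight as a product of the factors `1 + t 1[δf(σ) = 0]` and summing the
  character `W_γ` over the cochains that are closed on `S` (a subspace of codimension `rank S`, whose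
  annihilator is the span of the `∂σ`) gives, for every `(i-1)`-chain `γ` of the box, the finite
  volume identity `E(W_γ) = μ(V_γ)` (`integral_wilsonLoop_potts`).

The weight does not depend on the box, and it satisfies the FKG lattice condition because the rank is
submodular. The four functions theorem therefore shows that the random-cluster models on the boxes
are stochastically increasing (`randomCluster_real_mono`), so that the probabilities of increasing
cylinder events converge. Compactness of the space of probability measures and Stone–Weierstrass
turn this into weak convergence (`exists_tendsto_probabilityMeasure`).

The event `V_γ` is open and increasing but in general not closed, since there is no bound on the size
of the chains that `γ` may bound. Nevertheless its probability converges: the liminf bound is the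
portmanteau theorem, and the upper bound follows from monotonicity applied to the cylinder event
that `γ` bounds inside the box (`tendsto_randomCluster_real`). By the finite volume identity the expectations of all `W_γ`, that is,
of all characters of the compact group of cochains, then converge as well. This gives the weak limit
of the Potts lattice gauge theories, and the identity passes to the limit.
-/

namespace PlaquetteModel

variable {d : ℕ}

/-! ### Weak convergence from convergence of characters -/

open BoundedContinuousFunction in
/-- On a compact metrizable space, a sequence of probability measures converges weakly as soon as
the integrals of the members of a point separating, self-adjoint, multiplicative family of
continuous functions converge: a limit point exists by compactness, and it is unique because by the
Stone–Weierstrass theorem the family determines a measure. -/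
theorem exists_tendsto_probabilityMeasure {Ω : Type*} [TopologicalSpace Ω] [CompactSpace Ω]
    [TopologicalSpace.MetrizableSpace Ω] [MeasurableSpace Ω] [BorelSpace Ω]
    (μ : ℕ → ProbabilityMeasure Ω) (S : Submonoid (Ω →ᵇ ℂ)) (hstar : ∀ f ∈ S, star f ∈ S)
    (hsep : ∀ x y : Ω, x ≠ y → ∃ f ∈ S, f x ≠ f y)
    (hconv : ∀ f ∈ S, ∃ z : ℂ, Tendsto (fun n => ∫ x, f x ∂(μ n : Measure Ω)) atTop (𝓝 z)) :
    ∃ ν : ProbabilityMeasure Ω, Tendsto μ atTop (𝓝 ν) := by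
  have : PolishSpace Ω := by
    let _ := TopologicalSpace.metrizableSpaceMetric Ω
    infer_instance
  obtain ⟨ν, hν⟩ := exists_clusterPt_of_compactSpace (map μ atTop)
  refine ⟨ν, tendsto_nhds_of_unique_mapClusterPt (fun ν' hν' => ?_)⟩
  have key : ∀ ρ : ProbabilityMeasure Ω, MapClusterPt ρ atTop μ → ∀ f : Ω →ᵇ ℂ, ∀ z : ℂ,
      Tendsto (fun n => ∫ x, f x ∂(μ n : Measure Ω)) atTop (𝓝 z) →
      ∫ x, f x ∂(ρ : Measure Ω) = z := by
    intro ρ hρ f z hz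
    have hc : Continuous fun m : ProbabilityMeasure Ω => ∫ x, f x ∂(m : Measure Ω) := by
      rw [continuous_iff_continuousAt]
      intro m
      exact (ProbabilityMeasure.tendsto_iff_forall_integral_rclike_tendsto ℂ).1 tendsto_id f
    have h1 : ClusterPt _ _ := hρ.continuousAt_comp hc.continuousAt
    exact eq_of_nhds_neBot (h1.mono hz)
  let A : StarSubalgebra ℂ (Ω →ᵇ ℂ) :=
    { Algebra.adjoin ℂ (S : Set (Ω →ᵇ ℂ)) with
      star_mem' := by
        intro a ha
        have ha' : a ∈ Algebra.adjoin ℂ (S : Set (Ω →ᵇ ℂ)) := ha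
        change star a ∈ Algebra.adjoin ℂ (S : Set (Ω →ᵇ ℂ))
        induction ha' using Algebra.adjoin_induction with
        | mem x hx => exact Algebra.subset_adjoin (hstar x hx)
        | algebraMap r =>
          rw [← algebraMap_star_comm]
          exact Subalgebra.algebraMap_mem _ _
        | add x y hx hy h1 h2 =>
          rw [star_add]; exact add_mem (h1 hx) (h2 hy)
        | mul x y hx hy h1 h2 =>
          rw [star_mul]; exact mul_mem (h2 hy) (h1 hx) }
  have hA : ∀ f ∈ A, ∃ z : ℂ,
      Tendsto (fun n => ∫ x, f x ∂(μ n : Measure Ω)) atTop (𝓝 z) := by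
    intro f hf
    have hf' : f ∈ Subalgebra.toSubmodule (Algebra.adjoin ℂ (S : Set (Ω →ᵇ ℂ))) := hf
    rw [Algebra.adjoin_eq_span, Submonoid.closure_eq] at hf'
    induction hf' using Submodule.span_induction with
    | mem x hx => exact hconv x hx
    | zero => exact ⟨0, by simp⟩
    | add x y hx hy h1 h2 =>
      rw [← Submonoid.closure_eq S, ← Algebra.adjoin_eq_span] at hx hy
      obtain ⟨a, ha⟩ := h1 hx
      obtain ⟨b, hb⟩ := h2 hy
      refine ⟨a + b, (ha.add hb).congr fun n => ?_⟩
      exact (integral_add (x.integrable _) (y.integrable _)).symm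
    | smul c x hx h1 =>
      rw [← Submonoid.closure_eq S, ← Algebra.adjoin_eq_span] at hx
      obtain ⟨a, ha⟩ := h1 hx
      refine ⟨c * a, (ha.const_mul c).congr fun n => ?_⟩
      exact (integral_const_mul c _).symm
  have hsepA : (A.map (toContinuousMapStarₐ ℂ)).SeparatesPoints := by
    intro x y hxy
    obtain ⟨f, hf, hne⟩ := hsep x y hxy
    exact ⟨f, ⟨toContinuousMapStarₐ ℂ f, ⟨f, Algebra.subset_adjoin hf, rfl⟩, rfl⟩, hne⟩
  apply Subtype.ext
  change (ν' : Measure Ω) = (ν : Measure Ω)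
  refine ext_of_forall_mem_subalgebra_integral_eq_of_polish (𝕜 := ℂ) hsepA fun g hg => ?_
  obtain ⟨z, hz⟩ := hA g hg
  exact (key ν' hν' g z hz).trans (key ν hν g z hz).symm

/-! ### Normalized weights -/

/-- The integral against the image of a measure given by normalized weights. -/
theorem integral_normalizedPMF_map {α Ω : Type*} [Fintype α] [MeasurableSpace Ω] (w : α → ℝ)
    (hw : ∃ a, 0 < w a) (hw0 : ∀ a, 0 ≤ w a) (e : α → Ω) (h : Ω → ℂ)
    (hh : StronglyMeasurable h) :
    ∫ x, h x ∂((normalizedPMF w hw).map e).toMeasure =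
      (∑ a, (w a : ℂ) * h (e a)) / ∑ a, (w a : ℂ) := by
  let _ : MeasurableSpace α := ⊤
  have he : Measurable e := measurable_from_top
  rw [← PMF.toMeasure_map _ _ he, integral_map he.aemeasurable hh.aestronglyMeasurable,
    PMF.integral_eq_sum, Finset.sum_div]
  refine Finset.sum_congr rfl fun a _ => ?_
  have : ((normalizedPMF w hw) a).toReal = w a / ∑ b, w b := by
    rw [normalizedPMF, PMF.normalize_apply, tsum_fintype,
      ← ENNReal.ofReal_sum_of_nonneg fun b _ => hw0 b, ENNReal.toReal_mul, ENNReal.toReal_inv,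
      ENNReal.toReal_ofReal (hw0 a), ENNReal.toReal_ofReal (Finset.sum_nonneg fun b _ => hw0 b),
      div_eq_mul_inv]
  rw [this, Complex.real_smul]
  push_cast
  ring

/-! ### Character sums over annihilators -/

/-- The sum of a character over the annihilator of a subspace `K` vanishes unless the character is
trivial there, which by duality means that it is given by an element of `K`. -/
theorem sum_stdAddChar_annihilator {ι : Type*} [Fintype ι] [DecidableEq ι] {q : ℕ} [Fact q.Prime]
    (K : Submodule (ZMod q) (ι →₀ ZMod q)) (x : ι →₀ ZMod q) (P : (ι → ZMod q) → Prop)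
    [DecidablePred P] [Decidable (x ∈ K)]
    (hP : ∀ f, P f ↔ ∀ y ∈ K, Finsupp.linearCombination (ZMod q) f y = 0) :
    ∑ f : ι → ZMod q, (if P f then
      (ZMod.stdAddChar (Finsupp.linearCombination (ZMod q) f x) : ℂ) else 0) =
    (q : ℂ) ^ Fintype.card ι * ((q : ℂ)⁻¹ ^ Module.finrank (ZMod q) K *
      if x ∈ K then 1 else 0) := by
  classical
  let L := Finsupp.llift (ZMod q) (ZMod q) (ZMod q) ι
  have hL : ∀ f y, L f y = Finsupp.linearCombination (ZMod q) f y := fun f y => by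
    simp [L, Finsupp.linearCombination_apply]
  let U : Submodule (ZMod q) (ι → ZMod q) := K.dualAnnihilator.comap L.toLinearMap
  have hU : ∀ f, f ∈ U ↔ P f := fun f => by
    simp only [U, Submodule.mem_comap, LinearEquiv.coe_coe, Submodule.mem_dualAnnihilator, hL, hP]
  let ev : U →+ ZMod q :=
    { toFun := fun f => L f.1 x
      map_zero' := by simp
      map_add' := by simp }
  let ψ : AddChar U ℂ := ZMod.stdAddChar.compAddMonoidHom ev
  have h1 : ∑ f : ι → ZMod q, (if P f then
      (ZMod.stdAddChar (Finsupp.linearCombination (ZMod q) f x) : ℂ) else 0) = ∑ f : U, ψ f := by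
    rw [← Finset.sum_filter]
    simp only [← hL]
    exact Finset.sum_subtype (F := (inferInstance : Fintype U)) _ (by simp [hU]) _
  have hψ : ψ = 0 ↔ x ∈ K := by
    rw [← Subspace.forall_mem_dualAnnihilator_apply_eq_zero_iff K x]
    constructor
    · intro h φ hφ
      have := DFunLike.congr_fun h ⟨L.symm φ, by simpa [U] using hφ⟩
      have h0 : (ZMod.stdAddChar (φ x) : ℂ) = 1 := by simpa [ψ, ev] using this
      exact ZMod.injective_stdAddChar (h0.trans (AddChar.map_zero_eq_one _).symm)
    · intro h
      ext f
      have := h (L f.1) f.2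
      simp [ψ, ev, this]
  have hcard : (Fintype.card U : ℂ) =
      (q : ℂ) ^ Fintype.card ι * (q : ℂ)⁻¹ ^ Module.finrank (ZMod q) K := by
    have hq : (q : ℂ) ≠ 0 := Nat.cast_ne_zero.2 (Fact.out : q.Prime).ne_zero
    have e : U ≃ₗ[ZMod q] K.dualAnnihilator := L.ofSubmodule' _
    have h2 := Subspace.finrank_add_finrank_dualAnnihilator_eq K
    rw [Module.finrank_finsupp_self, ← e.finrank_eq] at h2
    rw [Module.card_eq_pow_finrank (K := ZMod q) (V := U), ZMod.card, ← h2, add_comm, pow_add,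
      mul_assoc, ← mul_pow, mul_inv_cancel₀ hq, one_pow, mul_one, Nat.cast_pow]
  rw [h1, AddChar.sum_eq_ite]
  simp only [hψ]
  split_ifs
  · rw [hcard, mul_one]
  · simp

/-! ### Boundaries and Betti numbers of percolation complexes -/

section Algebra

variable (F : Type*) [Field F]

/-- The span of the boundaries of the cubes in `S`. -/
noncomputable def boundarySpan (S : Set (Cube d)) : Submodule F (Cube d →₀ F) :=
  Submodule.span F (cubeBoundary F '' S)

instance finite_boundarySpan (S : Finset (Cube d)) :
    Module.Finite F (boundarySpan F (S : Set (Cube d))) :=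
  FiniteDimensional.span_of_finite F (S.finite_toSet.image _)

theorem boundarySpan_mono {S T : Set (Cube d)} (h : S ⊆ T) :
    boundarySpan F S ≤ boundarySpan F T :=
  Submodule.span_mono (Set.image_mono h)

theorem map_boundary_supported (S : Set (Cube d)) :
    (Finsupp.supported F F S).map (boundary F) = boundarySpan F S := by
  rw [Finsupp.supported_eq_span_single, Submodule.map_span, Set.image_image, boundarySpan]
  simp [boundary]

theorem boundaries_percolationComplex (X : Set (Cube d)) {i : ℕ} (hi : 0 < i)
    (ω : Plaquette d i → Bool) :
    boundaries F (percolationComplex X i ω) (i - 1) =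
      boundarySpan F {c | c ∈ X ∧ ∃ h : c.dim = i, ω ⟨c, h⟩ = true} := by
  rw [boundaries, chains, map_boundary_supported, Nat.sub_add_cancel hi]
  congr 1
  ext c
  simp only [percolationComplex, Set.mem_union, Set.mem_ofPred_eq]
  constructor
  · rintro ⟨h | h, h'⟩
    · omega
    · exact h
  · rintro ⟨h, h', h''⟩
    exact ⟨Or.inr ⟨h, h', h''⟩, h'⟩

theorem cycles_percolationComplex (X : Set (Cube d)) {i : ℕ} (hi : 0 < i)
    (ω : Plaquette d i → Bool) :
    cycles F (percolationComplex X i ω) (i - 1) = cycles F X (i - 1) := by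
  rw [cycles, cycles, chains, chains]
  congr 2
  ext c
  simp only [percolationComplex, Set.mem_union, Set.mem_ofPred_eq]
  constructor
  · rintro ⟨h | h, h'⟩
    · exact ⟨h.1, h'⟩
    · obtain ⟨_, h, _⟩ := h
      omega
  · rintro ⟨h, h'⟩
    exact ⟨Or.inl ⟨h, by omega⟩, h'⟩

/-- A set of cubes is a subcomplex if it is closed under passing to faces of codimension one. -/
def IsSubcomplex (X : Set (Cube d)) : Prop :=
  ∀ c ∈ X, ∀ j ∈ c.dirs, c.upperFace j ∈ X ∧ c.lowerFace j ∈ X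

variable {F} in
theorem IsSubcomplex.cubeBoundary_mem_chains {X : Set (Cube d)} (hX : IsSubcomplex X) {i : ℕ}
    {c : Cube d} (hc : c ∈ X) (hd : c.dim = i) : cubeBoundary F c ∈ chains F X (i - 1) := by
  refine Submodule.sum_mem _ fun j hj => Submodule.smul_mem _ _ (Submodule.sub_mem _ ?_ ?_)
  · exact Finsupp.single_mem_supported F _
      ⟨(hX c hc j hj).1, by rw [← hd]; exact Finset.card_erase_of_mem hj⟩
  · exact Finsupp.single_mem_supported F _
      ⟨(hX c hc j hj).2, by rw [← hd]; exact Finset.card_erase_of_mem hj⟩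

variable {F} in
theorem IsSubcomplex.boundarySpan_le_cycles {X : Set (Cube d)} (hX : IsSubcomplex X) {i : ℕ}
    {S : Set (Cube d)} (hS : S ⊆ {c | c ∈ X ∧ c.dim = i}) :
    boundarySpan F S ≤ cycles F X (i - 1) := by
  refine Submodule.span_le.2 ?_
  rintro _ ⟨c, hc, rfl⟩
  exact ⟨hX.cubeBoundary_mem_chains (hS hc).1 (hS hc).2, boundary_cubeBoundary F c⟩

theorem finite_cycles (X : Finset (Cube d)) (k : ℕ) :
    Module.Finite F (cycles F (X : Set (Cube d)) k) := by
  have : Finite {c | c ∈ (X : Set (Cube d)) ∧ c.dim = k} :=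
    (X.finite_toSet.subset fun c hc => hc.1).to_subtype
  have : Module.Finite F (chains F (X : Set (Cube d)) k) :=
    Module.Finite.equiv (Finsupp.supportedEquivFinsupp _).symm
  exact Submodule.finiteDimensional_of_le (inf_le_left : _ ≤ chains F (X : Set (Cube d)) k)

/-- The Betti number is the dimension of the cycle space, which does not depend on the
configuration, minus the rank of the family of boundaries of the open plaquettes. -/
theorem betti_percolationComplex_add_finrank {X : Finset (Cube d)}
    (hX : IsSubcomplex (X : Set (Cube d))) {i : ℕ} (hi : 0 < i) (ω : Plaquette d i → Bool) :
    betti F (percolationComplex (X : Set (Cube d)) i ω) (i - 1) +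
      Module.finrank F (boundarySpan F
        {c | c ∈ (X : Set (Cube d)) ∧ ∃ h : c.dim = i, ω ⟨c, h⟩ = true}) =
      Module.finrank F (cycles F (X : Set (Cube d)) (i - 1)) := by
  have := finite_cycles F X (i - 1)
  have hle := hX.boundarySpan_le_cycles (F := F) (i := i)
    (S := {c | c ∈ (X : Set (Cube d)) ∧ ∃ h : c.dim = i, ω ⟨c, h⟩ = true})
    fun c hc => ⟨hc.1, hc.2.1⟩
  unfold betti Homology
  rw [cycles_percolationComplex F _ hi, boundaries_percolationComplex F _ hi,
    ← (Submodule.submoduleOfEquivOfLe hle).finrank_eq]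
  exact Submodule.finrank_quotient_add_finrank _

end Algebra

/-! ### The boxes -/

theorem isSubcomplex_box (n : ℕ) : IsSubcomplex (box d n : Set (Cube d)) := by
  intro c hc j hj
  rw [Finset.mem_coe, mem_box] at hc
  simp only [Finset.mem_coe, mem_box]
  constructor
  · refine Finset.Subset.trans ?_ hc
    intro v hv
    simp only [Cube.vertices, Finset.mem_image, Finset.mem_powerset] at hv ⊢
    obtain ⟨T, hT, rfl⟩ := hv
    have hT' : T ⊆ c.dirs.erase j := hT
    have hjT : j ∉ T := fun h => Finset.notMem_erase j c.dirs (hT' h)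
    refine ⟨insert j T, Finset.insert_subset hj (hT'.trans (Finset.erase_subset _ _)), ?_⟩
    funext l
    by_cases hl : l = j
    · subst hl; simp [Cube.upperFace, hjT]
    · simp [Cube.upperFace, hl]
  · refine Finset.Subset.trans ?_ hc
    exact Finset.image_subset_image (Finset.powerset_mono.2 (Finset.erase_subset _ _))

theorem box_mono (d : ℕ) : Monotone (box d) := by
  intro m n h c hc
  rw [mem_box] at hc ⊢
  refine hc.trans (Finset.Icc_subset_Icc ?_ ?_)
  · intro j; simpa using h
  · intro j; simpa using h

theorem eventually_mem_box (c : Cube d) : ∀ᶠ n in atTop, c ∈ box d n := by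
  simp only [mem_box, Finset.subset_iff, boxVertices, Finset.mem_Icc, Pi.le_def]
  refine (Finset.eventually_all _).2 fun v _ => ?_
  simp only [← forall_and]
  refine eventually_all.2 fun j => ?_
  filter_upwards [eventually_ge_atTop (v j).natAbs] with n hn
  omega

/-! ### Evaluation of cochains -/

section Cochains

variable {F : Type*} [CommRing F]

theorem evalChain_zero {k : ℕ} (f : Plaquette d k → F) : evalChain F f 0 = 0 := by
  simp [evalChain]

theorem evalChain_add {k : ℕ} (f : Plaquette d k → F) (x y : Cube d →₀ F) :
    evalChain F f (x + y) = evalChain F f x + evalChain F f y := by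
  simp [evalChain, Finsupp.subtypeDomain_add]

theorem evalChain_single {k : ℕ} (f : Plaquette d k → F) (σ : Plaquette d k) (a : F) :
    evalChain F f (Finsupp.single σ.1 a) = a * f σ := by
  have : (Finsupp.single σ.1 a).subtypeDomain (fun c => c.dim = k) = Finsupp.single σ a := by
    ext τ
    simp [Finsupp.single_apply, Subtype.ext_iff]
  simp [evalChain, this]

theorem evalChain_extend {X : Finset (Cube d)} {k : ℕ} (f : cells X k → F)
    (y : cells X k →₀ F) :
    evalChain F (extend X k 0 f) (Finsupp.mapDomain Subtype.val y) =
      Finsupp.linearCombination F f y := by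
  induction y using Finsupp.induction_linear with
  | zero => simp [evalChain_zero]
  | add x y hx hy => rw [Finsupp.mapDomain_add, evalChain_add, hx, hy, map_add]
  | single c a =>
    have hc : c.1.dim = k := (Finset.mem_filter.1 c.2).2
    rw [Finsupp.mapDomain_single, evalChain_single _ ⟨c.1, hc⟩]
    simp [extend]

theorem exists_mapDomain_of_mem_chains {X : Finset (Cube d)} {k : ℕ} {γ : Cube d →₀ F}
    (hγ : γ ∈ chains F (X : Set (Cube d)) k) :
    ∃ x : cells X k →₀ F, Finsupp.mapDomain Subtype.val x = γ := by
  have : γ ∈ LinearMap.range (Finsupp.lmapDomain F F (Subtype.val : cells X k → Cube d)) := by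
    rw [Finsupp.range_lmapDomain]
    have h : Set.range (Subtype.val : cells X k → Cube d) =
        {c | c ∈ (X : Set (Cube d)) ∧ c.dim = k} := by
      ext c; simp [cells]
    rw [chains, Finsupp.supported_eq_span_single] at hγ
    rwa [← h, ← Set.range_comp] at hγ
  exact this

end Cochains

/-! ### The random-cluster weight of a finite set of plaquettes -/

/-- The weight `t^|S| q^(-rank S)` of a finite set `S` of plaquettes, where `rank S` is the dimension
over `ℤ/q` of the span of their boundaries. With `t = p / (1 - p)`, this is the weight of the
configuration `S` in the plaquette random-cluster model on any finite complex that contains `S`, up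
to a factor that depends only on the complex. -/
noncomputable def plaquetteWeight (q : ℕ) [Fact q.Prime] (t : ℝ) (S : Finset (Cube d)) : ℝ :=
  t ^ S.card * (q : ℝ)⁻¹ ^ Module.finrank (ZMod q) (boundarySpan (ZMod q) (S : Set (Cube d)))

section Weight

variable {q : ℕ} [hq : Fact q.Prime] {t : ℝ}

theorem plaquetteWeight_nonneg (ht : 0 ≤ t) (S : Finset (Cube d)) :
    0 ≤ plaquetteWeight q t S := by
  unfold plaquetteWeight
  positivity

theorem sum_plaquetteWeight_pos (ht : 0 ≤ t) (T : Finset (Cube d)) :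
    0 < ∑ S ∈ T.powerset, plaquetteWeight q t S := by
  refine Finset.sum_pos' (fun S _ => plaquetteWeight_nonneg ht S)
    ⟨∅, Finset.empty_mem_powerset T, ?_⟩
  have : (0 : ℝ) < q := Nat.cast_pos.2 hq.out.pos
  simp only [plaquetteWeight, Finset.card_empty, pow_zero, one_mul]
  positivity

/-- The lattice condition of Fortuin, Kasteleyn and Ginibre, which follows from the submodularity
of the rank and from `q ≥ 1`. -/
theorem plaquetteWeight_mul_le (ht : 0 ≤ t) (S T : Finset (Cube d)) :
    plaquetteWeight q t S * plaquetteWeight q t T ≤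
      plaquetteWeight q t (S ∩ T) * plaquetteWeight q t (S ∪ T) := by
  classical
  have hsup : boundarySpan (ZMod q) ((S ∪ T : Finset (Cube d)) : Set (Cube d)) =
      boundarySpan (ZMod q) (S : Set (Cube d)) ⊔ boundarySpan (ZMod q) (T : Set (Cube d)) := by
    rw [boundarySpan, Finset.coe_union, Set.image_union, Submodule.span_union]
    rfl
  have hinf : boundarySpan (ZMod q) ((S ∩ T : Finset (Cube d)) : Set (Cube d)) ≤
      boundarySpan (ZMod q) (S : Set (Cube d)) ⊓ boundarySpan (ZMod q) (T : Set (Cube d)) :=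
    le_inf (boundarySpan_mono _ (by simp)) (boundarySpan_mono _ (by simp))
  have h1 := Submodule.finrank_sup_add_finrank_inf_eq
    (boundarySpan (ZMod q) (S : Set (Cube d))) (boundarySpan (ZMod q) (T : Set (Cube d)))
  have h2 := Submodule.finrank_mono hinf
  rw [← hsup] at h1
  have hc := Finset.card_union_add_card_inter S T
  have h0 : (0 : ℝ) ≤ (q : ℝ)⁻¹ := by positivity
  have h1' : (q : ℝ)⁻¹ ≤ 1 := inv_le_one_of_one_le₀ (by exact_mod_cast hq.out.one_le)
  calc plaquetteWeight q t S * plaquetteWeight q t T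
      = t ^ (S.card + T.card) * (q : ℝ)⁻¹ ^
        (Module.finrank (ZMod q) (boundarySpan (ZMod q) (S : Set (Cube d))) +
          Module.finrank (ZMod q) (boundarySpan (ZMod q) (T : Set (Cube d)))) := by
        simp only [plaquetteWeight, pow_add]; ring
    _ ≤ t ^ (S.card + T.card) * (q : ℝ)⁻¹ ^
        (Module.finrank (ZMod q)
            (boundarySpan (ZMod q) ((S ∩ T : Finset (Cube d)) : Set (Cube d))) +
          Module.finrank (ZMod q)
            (boundarySpan (ZMod q) ((S ∪ T : Finset (Cube d)) : Set (Cube d)))) :=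
        mul_le_mul_of_nonneg_left (pow_le_pow_of_le_one h0 h1' (by omega)) (by positivity)
    _ = _ := by
        rw [← hc]
        simp only [plaquetteWeight, pow_add]; ring

open scoped FinsetFamily in
/-- Holley's comparison between a set of plaquettes and a larger one: the four functions theorem. -/
theorem sum_plaquetteWeight_mul_le (ht : 0 ≤ t) {X Y : Finset (Cube d)} (hXY : X ⊆ Y)
    {A : Finset (Cube d) → Prop} [DecidablePred A] (hA : ∀ S T, S ⊆ T → A S → A T) :
    (∑ S ∈ X.powerset, plaquetteWeight q t S * if A S then 1 else 0) *
        (∑ S ∈ Y.powerset, plaquetteWeight q t S) ≤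
      (∑ S ∈ X.powerset, plaquetteWeight q t S) *
        (∑ S ∈ Y.powerset, plaquetteWeight q t S * if A S then 1 else 0) := by
  have hw := plaquetteWeight_nonneg (d := d) (q := q) ht
  have hw' : ∀ S : Finset (Cube d), 0 ≤ plaquetteWeight q t S * if A S then 1 else 0 :=
    fun S => mul_nonneg (hw S) (by split_ifs <;> norm_num)
  have h1 : X.powerset ⊼ Y.powerset = X.powerset := by
    rw [← Finset.powerset_inter, Finset.inter_eq_left.2 hXY]
  have h2 : X.powerset ⊻ Y.powerset = Y.powerset := by
    rw [← Finset.powerset_union, Finset.union_eq_right.2 hXY]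
  have h := Finset.four_functions_theorem Y
    (f₁ := fun S => plaquetteWeight q t S * if A S then 1 else 0)
    (f₂ := plaquetteWeight q t) (f₃ := plaquetteWeight q t)
    (f₄ := fun S => plaquetteWeight q t S * if A S then 1 else 0) hw' hw hw hw' ?_
    (Finset.powerset_mono.2 hXY) (Finset.Subset.refl Y.powerset)
  · rwa [h1, h2] at h
  · intro S _ T _
    by_cases hS : A S
    · have := hA S (S ∪ T) Finset.subset_union_left hS
      simpa [hS, this] using plaquetteWeight_mul_le ht S T
    · simpa [hS] using mul_nonneg (hw _) (hw' _)

end Weight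

/-! ### Expectations in the random-cluster model -/

/-- The configuration of the `i`-plaquettes whose open plaquettes are those in `S`. -/
def openConfig (i : ℕ) (S : Finset (Cube d)) : Plaquette d i → Bool := fun σ => decide (σ.1 ∈ S)

/-- The configurations on the plaquettes of `X` correspond to the sets of such plaquettes. -/
theorem sum_extend_eq_sum_openConfig {R : Type*} [AddCommMonoid R] (X : Finset (Cube d)) (i : ℕ)
    (g : Finset (Cube d) → (Plaquette d i → Bool) → R) :
    ∑ ω : cells X i → Bool,
        g ((Finset.univ.filter fun σ => ω σ = true).map (Function.Embedding.subtype _))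
          (extend X i false ω) =
      ∑ S ∈ (cells X i).powerset, g S (openConfig i S) := by
  refine Finset.sum_bij'
    (fun ω _ => (Finset.univ.filter fun σ => ω σ = true).map (Function.Embedding.subtype _))
    (fun S _ σ => decide (σ.1 ∈ S)) ?_ ?_ ?_ ?_ ?_
  · intro ω _
    rw [Finset.mem_powerset]
    intro c hc
    simp only [Finset.mem_map, Finset.mem_filter] at hc
    obtain ⟨σ, _, rfl⟩ := hc
    exact σ.2
  · intro S _; exact Finset.mem_univ _
  · intro ω _
    funext σ
    simp
  · intro S hS
    ext c
    have hc : c ∈ S → c ∈ cells X i := fun h => Finset.mem_powerset.1 hS h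
    simp only [Finset.mem_map, Finset.mem_filter, Finset.mem_univ, true_and, decide_eq_true_eq]
    constructor
    · rintro ⟨σ, h, rfl⟩; exact h
    · exact fun h => ⟨⟨c, hc h⟩, h, rfl⟩
  · intro ω _
    congr 1
    funext σ
    simp only [extend, openConfig]
    split_ifs with h
    · simp [h]
    · simp [h]

section RandomCluster

variable {i q : ℕ} [hq : Fact q.Prime]

/-- The weights of the random-cluster model depend on the complex only through a factor. -/
theorem rcWeight_eq {X : Finset (Cube d)} (hX : IsSubcomplex (X : Set (Cube d))) (hi : 0 < i)
    {p : ℝ} (hp : p < 1) (ω : cells X i → Bool) :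
    rcWeight (ZMod q) X i p q ω =
      ((1 - p) ^ (cells X i).card *
        (q : ℝ) ^ Module.finrank (ZMod q) (cycles (ZMod q) (X : Set (Cube d)) (i - 1))) *
      plaquetteWeight q (p / (1 - p))
        ((Finset.univ.filter fun σ => ω σ = true).map (Function.Embedding.subtype _)) := by
  have hq0 : (q : ℝ) ≠ 0 := Nat.cast_ne_zero.2 hq.out.ne_zero
  have hp0 : 1 - p ≠ 0 := by linarith
  have hcard : (Finset.univ.filter fun σ => ω σ = true).card ≤ (cells X i).card := by
    simpa using Finset.card_filter_le (Finset.univ : Finset (cells X i)) fun σ => ω σ = true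
  have hset : {c | c ∈ (X : Set (Cube d)) ∧ ∃ h : c.dim = i, extend X i false ω ⟨c, h⟩ = true} =
      (((Finset.univ.filter fun σ => ω σ = true).map (Function.Embedding.subtype _) :
        Finset (Cube d)) : Set (Cube d)) := by
    ext c
    simp only [extend, Finset.mem_coe, Set.mem_ofPred_eq, Finset.mem_map, Finset.mem_filter,
      Finset.mem_univ, true_and]
    constructor
    · rintro ⟨hc, hd, h⟩
      have hmem : c ∈ cells X i := Finset.mem_filter.2 ⟨hc, hd⟩
      rw [dif_pos hmem] at h
      exact ⟨⟨c, hmem⟩, h, rfl⟩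
    · rintro ⟨σ, h, rfl⟩
      have hmem := Finset.mem_filter.1 σ.2
      exact ⟨hmem.1, hmem.2, by simpa using h⟩
  rw [rcWeight, plaquetteWeight, ← betti_percolationComplex_add_finrank (ZMod q) hX hi
    (extend X i false ω), hset, Finset.card_map, pow_add, inv_pow, div_pow]
  obtain ⟨m, hm⟩ := Nat.exists_eq_add_of_le hcard
  rw [hm, Nat.add_sub_cancel_left, pow_add]
  field_simp

theorem integral_randomCluster {X : Finset (Cube d)} (hX : IsSubcomplex (X : Set (Cube d)))
    (hi : 0 < i) {p : unitInterval} (hp : (p : ℝ) < 1) {t : ℝ} (ht : t = p / (1 - p))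
    (h : (Plaquette d i → Bool) → ℂ) (hh : StronglyMeasurable h) :
    ∫ ω, h ω ∂(randomCluster X i q p : Measure (Plaquette d i → Bool)) =
      (∑ S ∈ (cells X i).powerset, (plaquetteWeight q t S : ℂ) * h (openConfig i S)) /
        (∑ S ∈ (cells X i).powerset, plaquetteWeight q t S : ℝ) := by
  subst ht
  have hp0 : 0 < 1 - (p : ℝ) := by linarith
  have hp1 : 0 ≤ (p : ℝ) := p.2.1
  have hq0 : (0 : ℝ) < q := Nat.cast_pos.2 hq.out.pos
  have hC : (((1 - (p : ℝ)) ^ (cells X i).card * (q : ℝ) ^ Module.finrank (ZMod q)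
      (cycles (ZMod q) (X : Set (Cube d)) (i - 1)) : ℝ) : ℂ) ≠ 0 := by
    rw [Complex.ofReal_ne_zero]; positivity
  refine (integral_normalizedPMF_map _ _ (fun ω => ?_) _ h hh).trans ?_
  · rw [rcWeight_eq hX hi hp]
    exact mul_nonneg (by positivity) (plaquetteWeight_nonneg (by positivity) _)
  · simp only [rcWeight_eq hX hi hp]
    rw [sum_extend_eq_sum_openConfig X i fun S η =>
        ((((1 - (p : ℝ)) ^ (cells X i).card * (q : ℝ) ^ Module.finrank (ZMod q)
          (cycles (ZMod q) (X : Set (Cube d)) (i - 1))) *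
          plaquetteWeight q (p / (1 - p)) S : ℝ) : ℂ) * h η,
      sum_extend_eq_sum_openConfig X i fun S _ =>
        ((((1 - (p : ℝ)) ^ (cells X i).card * (q : ℝ) ^ Module.finrank (ZMod q)
          (cycles (ZMod q) (X : Set (Cube d)) (i - 1))) *
          plaquetteWeight q (p / (1 - p)) S : ℝ) : ℂ)]
    simp only [Complex.ofReal_mul _ (plaquetteWeight _ _ _), mul_assoc _ (Complex.ofReal _) (h _),
      ← Finset.mul_sum]
    rw [mul_div_mul_left _ _ hC, Complex.ofReal_sum]

theorem randomCluster_real {X : Finset (Cube d)} (hX : IsSubcomplex (X : Set (Cube d)))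
    (hi : 0 < i) {p : unitInterval} (hp : (p : ℝ) < 1) {t : ℝ} (ht : t = p / (1 - p))
    {A : Set (Plaquette d i → Bool)} (hA : MeasurableSet A)
    [DecidablePred fun S => openConfig i S ∈ A] :
    (randomCluster X i q p : Measure (Plaquette d i → Bool)).real A =
      (∑ S ∈ (cells X i).powerset, plaquetteWeight q t S * if openConfig i S ∈ A then 1 else 0) /
        ∑ S ∈ (cells X i).powerset, plaquetteWeight q t S := by
  have h := integral_randomCluster (q := q) hX hi hp ht (A.indicator fun _ => (1 : ℂ))
    (stronglyMeasurable_const.indicator hA)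
  rw [integral_indicator hA, setIntegral_const, Complex.real_smul, mul_one] at h
  apply Complex.ofReal_injective
  rw [h]
  push_cast
  congr 1
  refine Finset.sum_congr rfl fun S _ => ?_
  by_cases hS : openConfig i S ∈ A <;> simp [hS]

/-- The random-cluster models on growing complexes with free boundary conditions are stochastically
increasing. -/
theorem randomCluster_real_mono {X Y : Finset (Cube d)} (hX : IsSubcomplex (X : Set (Cube d)))
    (hY : IsSubcomplex (Y : Set (Cube d))) (hXY : X ⊆ Y) (hi : 0 < i) {p : unitInterval}
    (hp : (p : ℝ) < 1) {A : Set (Plaquette d i → Bool)} (hA : MeasurableSet A)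
    (hA' : IsUpperSet A) :
    (randomCluster X i q p : Measure (Plaquette d i → Bool)).real A ≤
      (randomCluster Y i q p : Measure (Plaquette d i → Bool)).real A := by
  classical
  have ht : 0 ≤ (p : ℝ) / (1 - p) := div_nonneg p.2.1 (by linarith)
  rw [randomCluster_real hX hi hp rfl hA, randomCluster_real hY hi hp rfl hA,
    div_le_div_iff₀ (sum_plaquetteWeight_pos ht _) (sum_plaquetteWeight_pos ht _),
    mul_comm (∑ S ∈ (cells Y i).powerset, _ * _)]
  refine sum_plaquetteWeight_mul_le ht (Finset.filter_subset_filter _ hXY) fun S T hST hS =>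
    hA' (fun σ => ?_) hS
  simp only [openConfig, Bool.le_iff_imp, decide_eq_true_eq]
  exact fun h => hST h

end RandomCluster

/-! ### Expectations of Wilson loop variables -/

section Potts

variable {i q : ℕ} [hq : Fact q.Prime]

open Classical in
/-- For fixed `S`, the cochains that are closed on the plaquettes of `S` contribute to the sum over
all cochains exactly when `γ` bounds in `S`. -/
theorem sum_wilsonLoop_closed {X S : Finset (Cube d)} (hX : IsSubcomplex (X : Set (Cube d)))
    (hS : S ⊆ cells X i) {γ : Cube d →₀ ZMod q}
    (hγ : γ ∈ chains (ZMod q) (X : Set (Cube d)) (i - 1)) :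
    ∑ f : cells X (i - 1) → ZMod q,
      (if ∀ σ ∈ S, coboundary (ZMod q) (extend X (i - 1) 0 f) σ = 0 then
        wilsonLoop γ (extend X (i - 1) 0 f) else 0) =
    (q : ℂ) ^ Fintype.card (cells X (i - 1)) *
      ((q : ℂ)⁻¹ ^ Module.finrank (ZMod q) (boundarySpan (ZMod q) (S : Set (Cube d))) *
        if γ ∈ boundarySpan (ZMod q) (S : Set (Cube d)) then 1 else 0) := by
  obtain ⟨x, rfl⟩ := exists_mapDomain_of_mem_chains hγ
  let e := Finsupp.lmapDomain (ZMod q) (ZMod q) (Subtype.val : cells X (i - 1) → Cube d)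
  have he : Function.Injective e := Finsupp.mapDomain_injective Subtype.val_injective
  have hr : ∀ σ ∈ S, ∃ y, e y = cubeBoundary (ZMod q) σ := fun σ hσ =>
    exists_mapDomain_of_mem_chains (hX.cubeBoundary_mem_chains
      (Finset.mem_filter.1 (hS hσ)).1 (Finset.mem_filter.1 (hS hσ)).2)
  let K := (boundarySpan (ZMod q) (S : Set (Cube d))).comap e
  have hK : K.map e = boundarySpan (ZMod q) (S : Set (Cube d)) := by
    refine Submodule.map_comap_eq_of_le (Submodule.span_le.2 ?_)
    rintro _ ⟨σ, hσ, rfl⟩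
    exact hr σ hσ
  have hrank : Module.finrank (ZMod q) K =
      Module.finrank (ZMod q) (boundarySpan (ZMod q) (S : Set (Cube d))) := by
    rw [← hK]
    exact (Submodule.equivMapOfInjective e he K).finrank_eq
  have h := sum_stdAddChar_annihilator K x
    (fun f => ∀ σ ∈ S, coboundary (ZMod q) (extend X (i - 1) 0 f) σ = 0) fun f => by
    constructor
    · intro hf y hy
      have hle : boundarySpan (ZMod q) (S : Set (Cube d)) ≤
          (LinearMap.ker (Finsupp.linearCombination (ZMod q) f)).map e := by
        refine Submodule.span_le.2 ?_
        rintro _ ⟨σ, hσ, rfl⟩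
        obtain ⟨z, hz⟩ := hr σ hσ
        refine ⟨z, ?_, hz⟩
        have := hf σ hσ
        rwa [coboundary, ← hz, Finsupp.lmapDomain_apply, evalChain_extend] at this
      obtain ⟨z, hz, hzy⟩ := hle hy
      rw [← he hzy]
      exact hz
    · intro hf σ hσ
      obtain ⟨z, hz⟩ := hr σ hσ
      rw [coboundary, ← hz, Finsupp.lmapDomain_apply, evalChain_extend]
      refine hf z ?_
      change e z ∈ boundarySpan (ZMod q) (S : Set (Cube d))
      rw [hz]
      exact Submodule.subset_span ⟨σ, hσ, rfl⟩
  have hm : x ∈ K ↔ Finsupp.mapDomain Subtype.val x ∈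
    boundarySpan (ZMod q) (S : Set (Cube d)) := Iff.rfl
  rw [← hrank]
  simp only [wilsonLoop, evalChain_extend, ← hm]
  exact h

/-- The Edwards–Sokal expansion: the Boltzmann weight is a product over the plaquettes `σ` of
`1 + (e^β - 1) 1[δf(σ) = 0]`. -/
theorem exp_hamiltonian_eq_sum (X : Finset (Cube d)) (β : ℝ) (f : cells X (i - 1) → ZMod q) :
    Real.exp (-β * hamiltonian X i q f) = ∑ S ∈ (cells X i).powerset,
      if ∀ σ ∈ S, coboundary (ZMod q) (extend X (i - 1) 0 f) σ = 0 then
        (Real.exp β - 1) ^ S.card else 0 := by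
  rw [hamiltonian, neg_mul_neg, Finset.mul_sum, Real.exp_sum]
  have h : ∀ σ, Real.exp (β * if coboundary (ZMod q) (extend X (i - 1) 0 f) σ = 0 then 1 else 0) =
      1 + if coboundary (ZMod q) (extend X (i - 1) 0 f) σ = 0 then Real.exp β - 1 else 0 := by
    intro σ
    split_ifs <;> simp
  simp only [h]
  rw [Finset.prod_one_add]
  refine Finset.sum_congr rfl fun S _ => ?_
  rw [Finset.prod_ite_zero, Finset.prod_const]

open Classical in
theorem sum_exp_hamiltonian_mul_wilsonLoop {X : Finset (Cube d)}
    (hX : IsSubcomplex (X : Set (Cube d))) (β : ℝ) {γ : Cube d →₀ ZMod q}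
    (hγ : γ ∈ chains (ZMod q) (X : Set (Cube d)) (i - 1)) :
    ∑ f : cells X (i - 1) → ZMod q,
      ((Real.exp (-β * hamiltonian X i q f) : ℝ) : ℂ) * wilsonLoop γ (extend X (i - 1) 0 f) =
    (q : ℂ) ^ Fintype.card (cells X (i - 1)) *
      ∑ S ∈ (cells X i).powerset, (plaquetteWeight q (Real.exp β - 1) S : ℂ) *
        if γ ∈ boundarySpan (ZMod q) (S : Set (Cube d)) then 1 else 0 := by
  simp only [exp_hamiltonian_eq_sum, Complex.ofReal_sum, Finset.sum_mul]
  rw [Finset.sum_comm, Finset.mul_sum]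
  refine Finset.sum_congr rfl fun S hS => ?_
  have h := sum_wilsonLoop_closed hX (Finset.mem_powerset.1 hS) hγ
  rw [plaquetteWeight]
  push_cast
  rw [mul_assoc, mul_left_comm, ← h, Finset.mul_sum]
  refine Finset.sum_congr rfl fun f _ => ?_
  split_ifs <;> simp

/-- The expectation of a Wilson loop variable in a finite complex is the probability that the loop
bounds in the random-cluster model. This holds for all chains `γ`; both sides vanish unless `γ` is a
cycle. -/
theorem integral_wilsonLoop_potts {X : Finset (Cube d)} (hX : IsSubcomplex (X : Set (Cube d)))
    (hi : 0 < i) {β : ℝ} {p : unitInterval} (hp : (p : ℝ) = 1 - Real.exp (-β))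
    {γ : Cube d →₀ ZMod q} (hγ : γ ∈ chains (ZMod q) (X : Set (Cube d)) (i - 1))
    (hW : StronglyMeasurable (wilsonLoop γ : (Plaquette d (i - 1) → ZMod q) → ℂ))
    (hV : MeasurableSet (nullHomologous i γ)) :
    ∫ f, wilsonLoop γ f ∂(potts X i q β : Measure (Plaquette d (i - 1) → ZMod q)) =
      ((randomCluster X i q p : Measure (Plaquette d i → Bool)).real (nullHomologous i γ) : ℂ) := by
  classical
  have hq0 : (q : ℂ) ≠ 0 := Nat.cast_ne_zero.2 hq.out.ne_zero
  have hp1 : (p : ℝ) < 1 := by rw [hp]; linarith [Real.exp_pos (-β)]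
  have ht : Real.exp β - 1 = p / (1 - p) := by
    rw [hp, Real.exp_neg]
    field_simp
    ring
  refine (integral_normalizedPMF_map _ _ (fun f => (Real.exp_pos _).le) _ _ hW).trans ?_
  have h0 := sum_exp_hamiltonian_mul_wilsonLoop (i := i) hX β
    (zero_mem (chains (ZMod q) (X : Set (Cube d)) (i - 1)))
  simp only [wilsonLoop, evalChain_zero, AddChar.map_zero_eq_one, mul_one, zero_mem, if_true] at h0
  rw [sum_exp_hamiltonian_mul_wilsonLoop hX β hγ, h0, mul_div_mul_left _ _ (pow_ne_zero _ hq0),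
    randomCluster_real hX hi hp1 ht hV]
  push_cast
  congr 1
  refine Finset.sum_congr rfl fun S hS => ?_
  have : openConfig i S ∈ nullHomologous i γ ↔ γ ∈ boundarySpan (ZMod q) (S : Set (Cube d)) := by
    rw [nullHomologous, Set.mem_ofPred_eq, boundaries_percolationComplex _ _ hi]
    have hset : {c : Cube d | c ∈ (Set.univ : Set (Cube d)) ∧
        ∃ h : c.dim = i, openConfig i S ⟨c, h⟩ = true} = (S : Set (Cube d)) := by
      ext c
      have : c ∈ S → c.dim = i := fun h =>
        (Finset.mem_filter.1 (Finset.mem_powerset.1 hS h)).2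
      simpa [openConfig] using this
    rw [hset]
  by_cases hb : γ ∈ boundarySpan (ZMod q) (S : Set (Cube d)) <;> simp [this, hb]

end Potts

/-! ### The event that a chain bounds -/

section NullHomologous

variable {i q : ℕ} [hq : Fact q.Prime]

/-- A chain with boundary `γ` has finitely many plaquettes. -/
theorem isOpen_nullHomologous (hi : 0 < i) (γ : Cube d →₀ ZMod q) :
    IsOpen (nullHomologous i γ) := by
  rw [isOpen_iff_mem_nhds]
  rintro ω ⟨ρ, hρ, rfl⟩
  have hev : ∀ᶠ ω' in 𝓝 ω, ∀ c ∈ ρ.support, ∀ h : c.dim = i, ω' ⟨c, h⟩ = ω ⟨c, h⟩ := by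
    refine (Finset.eventually_all _).2 fun c _ => ?_
    by_cases h : c.dim = i
    · have : ∀ᶠ ω' : Plaquette d i → Bool in 𝓝 ω, ω' ⟨c, h⟩ ∈ ({ω ⟨c, h⟩} : Set Bool) :=
        (continuous_apply (⟨c, h⟩ : Plaquette d i)).continuousAt.eventually
          ((isOpen_discrete _).mem_nhds rfl)
      filter_upwards [this] with ω' hω' _
      exact hω'
    · exact Eventually.of_forall fun _ h' => absurd h' h
  filter_upwards [hev] with ω' hω'
  refine ⟨ρ, fun c hc => ?_, rfl⟩
  obtain ⟨h | ⟨h, hd, ho⟩, h'⟩ := hρ hc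
  · exact absurd h.2 (by omega)
  · exact ⟨Or.inr ⟨h, hd, by rw [hω' c hc hd, ho]⟩, h'⟩

theorem isUpperSet_nullHomologous (hi : 0 < i) (γ : Cube d →₀ ZMod q) :
    IsUpperSet (nullHomologous i γ) := by
  intro ω ω' h hω
  rw [nullHomologous, Set.mem_ofPred_eq, boundaries_percolationComplex _ _ hi] at hω ⊢
  refine boundarySpan_mono _ ?_ hω
  rintro c ⟨hc, hd, ho⟩
  exact ⟨hc, hd, Bool.le_iff_imp.1 (h ⟨c, hd⟩) ho⟩

end NullHomologous

/-! ### The infinite volume random-cluster model -/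

section RandomClusterLimit

variable {i q : ℕ} [hq : Fact q.Prime] {p : unitInterval}

/-- Close all plaquettes outside of `X`. -/
def truncate (X : Finset (Cube d)) (i : ℕ) (ω : Plaquette d i → Bool) : Plaquette d i → Bool :=
  extend X i false fun σ => ω ⟨σ.1, (Finset.mem_filter.1 σ.2).2⟩

theorem truncate_apply (X : Finset (Cube d)) (ω : Plaquette d i → Bool) (σ : Plaquette d i) :
    truncate X i ω σ = if σ.1 ∈ cells X i then ω σ else false := by
  simp only [truncate, extend]
  split_ifs <;> rfl

theorem truncate_openConfig {X S : Finset (Cube d)} (hS : S ⊆ cells X i) :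
    truncate X i (openConfig i S) = openConfig i S := by
  funext σ
  rw [truncate_apply]
  split_ifs with h
  · rfl
  · simpa [openConfig] using fun h' => h (hS h')

theorem isClopen_preimage_truncate (X : Finset (Cube d)) (U : Set (Plaquette d i → Bool)) :
    IsClopen (truncate X i ⁻¹' U) := by
  have hc : Continuous fun (ω : Plaquette d i → Bool) (σ : cells X i) =>
      ω ⟨σ.1, (Finset.mem_filter.1 σ.2).2⟩ := by fun_prop
  exact (isClopen_discrete (extend X i false ⁻¹' U)).preimage hc

theorem preimage_truncate_subset (X : Finset (Cube d)) {U : Set (Plaquette d i → Bool)}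
    (hU : IsUpperSet U) : truncate X i ⁻¹' U ⊆ U := by
  refine fun ω hω => hU (fun σ => ?_) hω
  rw [truncate_apply]
  split_ifs
  · exact le_rfl
  · exact Bool.false_le _

theorem isUpperSet_preimage_truncate (X : Finset (Cube d)) {U : Set (Plaquette d i → Bool)}
    (hU : IsUpperSet U) : IsUpperSet (truncate X i ⁻¹' U) := by
  intro ω ω' h hω
  refine hU (fun σ => ?_) hω
  rw [truncate_apply, truncate_apply]
  split_ifs
  · exact h σ
  · exact le_rfl

theorem randomCluster_real_box_mono (hi : 0 < i) (hp : (p : ℝ) < 1)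
    {A : Set (Plaquette d i → Bool)} (hA : MeasurableSet A) (hA' : IsUpperSet A) :
    Monotone fun n => (randomCluster (box d n) i q p : Measure (Plaquette d i → Bool)).real A :=
  fun _ _ h => randomCluster_real_mono (isSubcomplex_box _) (isSubcomplex_box _) (box_mono d h)
    hi hp hA hA'

/-- The random-cluster models on the boxes converge: the probabilities of the events that all
plaquettes of a given finite set are open increase with the box. -/
theorem tendsto_randomCluster (d : ℕ) (hi : 0 < i) (hp : (p : ℝ) < 1) :
    Tendsto (fun n => randomCluster (box d n) i q p) atTop (𝓝 (randomClusterZd d i q p)) := by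
  classical
  let E : Finset (Plaquette d i) → Set (Plaquette d i → Bool) :=
    fun T => {ω | ∀ σ ∈ T, ω σ = true}
  have hE : ∀ T, IsClopen (E T) := fun T => by
    have : E T = ⋂ σ ∈ T, (fun ω : Plaquette d i → Bool => ω σ) ⁻¹' {true} := by
      ext; simp [E]
    rw [this]
    exact isClopen_biInter_finset fun σ _ => (isClopen_discrete _).preimage (continuous_apply σ)
  let M : Submonoid (BoundedContinuousFunction (Plaquette d i → Bool) ℂ) :=
    { carrier := {f | ∃ T, ∀ ω, f ω = (E T).indicator (fun _ => 1) ω}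
      one_mem' := ⟨∅, fun ω => by simp [E]⟩
      mul_mem' := by
        rintro f g ⟨S, hS⟩ ⟨T, hT⟩
        refine ⟨S ∪ T, fun ω => ?_⟩
        have : E (S ∪ T) = E S ∩ E T := by
          ext ω; simp [E, or_imp, forall_and]
        rw [BoundedContinuousFunction.mul_apply, hS, hT, this, ← Set.indicator_indicator]
        by_cases h : ω ∈ E S <;> simp [h] }
  refine tendsto_nhds_limUnder (exists_tendsto_probabilityMeasure _ M ?_ ?_ ?_)
  · rintro f ⟨T, hT⟩
    refine ⟨T, fun ω => ?_⟩
    rw [BoundedContinuousFunction.star_apply, hT]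
    by_cases h : ω ∈ E T <;> simp [h]
  · intro x y hxy
    obtain ⟨σ, hσ⟩ := Function.ne_iff.1 hxy
    have hcont : Continuous ((E {σ}).indicator fun _ => (1 : ℂ)) :=
      (IsClopen.continuous_indicator (hE _) continuous_const)
    refine ⟨BoundedContinuousFunction.mkOfCompact ⟨_, hcont⟩, ⟨{σ}, fun ω => rfl⟩, ?_⟩
    change (E {σ}).indicator (fun _ => (1 : ℂ)) x ≠ (E {σ}).indicator (fun _ => (1 : ℂ)) y
    have hmem : ∀ ω, ω ∈ E {σ} ↔ ω σ = true := fun ω => by simp only [E]; simp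
    simp only [Set.indicator, hmem]
    cases hx : x σ <;> cases hy : y σ <;> simp [hx, hy] at hσ ⊢
  · rintro f ⟨T, hT⟩
    have hmono := randomCluster_real_box_mono (q := q) (p := p) hi hp (hE T).isOpen.measurableSet
      (fun ω ω' h hω σ hσ => Bool.le_iff_imp.1 (h σ) (hω σ hσ))
    have hlim := tendsto_atTop_ciSup hmono ⟨1, by rintro _ ⟨n, rfl⟩; exact measureReal_le_one⟩
    refine ⟨_, ((Complex.continuous_ofReal.tendsto _).comp hlim).congr fun n => ?_⟩
    simp only [hT, Function.comp_apply]
    rw [integral_indicator (hE T).isOpen.measurableSet, setIntegral_const, Complex.real_smul,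
      mul_one]

/-- Weak convergence alone gives a lower bound for the probability of an open set. For upper sets
the matching upper bound comes from stochastic monotonicity, applied to the cylinder event that `U`
already occurs inside the box. -/
theorem tendsto_randomCluster_real (hi : 0 < i) (hp : (p : ℝ) < 1)
    {U : Set (Plaquette d i → Bool)} (hU : IsOpen U) (hU' : IsUpperSet U) :
    Tendsto (fun n => (randomCluster (box d n) i q p : Measure (Plaquette d i → Bool)).real U)
      atTop (𝓝 ((randomClusterZd d i q p : Measure (Plaquette d i → Bool)).real U)) := by
  classical
  have hlim := tendsto_randomCluster (q := q) d hi hp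
  have hle : ∀ n, (randomCluster (box d n) i q p : Measure (Plaquette d i → Bool)) U ≤
      (randomClusterZd d i q p : Measure (Plaquette d i → Bool)) U := by
    intro n
    have hclopen := isClopen_preimage_truncate (box d n) U
    have hmeas : MeasurableSet (truncate (box d n) i ⁻¹' U) := hclopen.isOpen.measurableSet
    have h1 : (randomCluster (box d n) i q p : Measure (Plaquette d i → Bool)).real U =
        (randomCluster (box d n) i q p : Measure (Plaquette d i → Bool)).real
          (truncate (box d n) i ⁻¹' U) := by
      rw [randomCluster_real (isSubcomplex_box n) hi hp rfl hU.measurableSet,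
        randomCluster_real (isSubcomplex_box n) hi hp rfl hmeas]
      congr 1
      refine Finset.sum_congr rfl fun S hS => ?_
      simp only [Set.mem_preimage, truncate_openConfig (Finset.mem_powerset.1 hS)]
    have h2 : Tendsto (fun m => (randomCluster (box d m) i q p :
        Measure (Plaquette d i → Bool)).real (truncate (box d n) i ⁻¹' U)) atTop
        (𝓝 ((randomClusterZd d i q p : Measure (Plaquette d i → Bool)).real
          (truncate (box d n) i ⁻¹' U))) :=
      (ENNReal.tendsto_toReal (measure_ne_top _ _)).comp
        (ProbabilityMeasure.tendsto_measure_of_null_frontier_of_tendsto' hlim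
          (by simp [hclopen.frontier_eq]))
    have h3 := (randomCluster_real_box_mono (q := q) hi hp hmeas
      (isUpperSet_preimage_truncate (box d n) hU')).ge_of_tendsto h2 n
    rw [← ENNReal.toReal_le_toReal (measure_ne_top _ _) (measure_ne_top _ _)]
    exact (h1.trans_le h3).trans (measureReal_mono (preimage_truncate_subset _ hU'))
  refine (ENNReal.tendsto_toReal (measure_ne_top _ _)).comp
    (tendsto_of_le_liminf_of_limsup_le
      (ProbabilityMeasure.le_liminf_measure_open_of_tendsto hlim hU) ?_)
  exact limsup_le_of_le (h := Eventually.of_forall hle)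

end RandomClusterLimit

/-! ### The infinite volume Potts lattice gauge theory -/

section PottsLimit

variable {i q : ℕ} [hq : Fact q.Prime]

theorem continuous_wilsonLoop {k : ℕ} (γ : Cube d →₀ ZMod q) :
    Continuous (wilsonLoop γ : (Plaquette d k → ZMod q) → ℂ) := by
  have h : Continuous fun f : Plaquette d k → ZMod q => evalChain (ZMod q) f γ := by
    simp only [evalChain, Finsupp.linearCombination_apply, Finsupp.sum]
    fun_prop
  exact continuous_of_discreteTopology.comp h

theorem eventually_mem_chains_box {F : Type*} [CommRing F] {k : ℕ} {γ : Cube d →₀ F}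
    (hγ : γ ∈ chains F (Set.univ : Set (Cube d)) k) :
    ∀ᶠ n in atTop, γ ∈ chains F (box d n : Set (Cube d)) k := by
  have : ∀ᶠ n in atTop, ∀ c ∈ γ.support, c ∈ box d n :=
    (Finset.eventually_all _).2 fun c _ => eventually_mem_box c
  filter_upwards [this] with n hn c hc
  exact ⟨hn c hc, (hγ hc).2⟩

theorem tendsto_integral_wilsonLoop (hi : 0 < i) {β : ℝ} {p : unitInterval}
    (hp : (p : ℝ) = 1 - Real.exp (-β)) {γ : Cube d →₀ ZMod q}
    (hγ : γ ∈ chains (ZMod q) (Set.univ : Set (Cube d)) (i - 1)) :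
    Tendsto (fun n => ∫ f, wilsonLoop γ f
        ∂(potts (box d n) i q β : Measure (Plaquette d (i - 1) → ZMod q))) atTop
      (𝓝 ((randomClusterZd d i q p : Measure (Plaquette d i → Bool)).real
        (nullHomologous i γ) : ℂ)) := by
  have hp1 : (p : ℝ) < 1 := by rw [hp]; linarith [Real.exp_pos (-β)]
  have hopen := isOpen_nullHomologous hi γ
  have h := tendsto_randomCluster_real (q := q) hi hp1 hopen (isUpperSet_nullHomologous hi γ)
  refine ((Complex.continuous_ofReal.tendsto _).comp h).congr' ?_
  filter_upwards [eventually_mem_chains_box hγ] with n hn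
  exact (integral_wilsonLoop_potts (isSubcomplex_box n) hi hp hn
    (continuous_wilsonLoop γ).stronglyMeasurable hopen.measurableSet).symm

/-- The Potts lattice gauge theories on the boxes converge: the Wilson loop variables of all
chains are the characters of the group of cochains. -/
theorem tendsto_potts (d : ℕ) (hi : 0 < i) {β : ℝ} {p : unitInterval}
    (hp : (p : ℝ) = 1 - Real.exp (-β)) :
    Tendsto (fun n => potts (box d n) i q β) atTop (𝓝 (pottsZd d i q β)) := by
  let M : Submonoid (BoundedContinuousFunction (Plaquette d (i - 1) → ZMod q) ℂ) :=
    { carrier := {g | ∃ γ ∈ chains (ZMod q) (Set.univ : Set (Cube d)) (i - 1),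
        ∀ f, g f = wilsonLoop γ f}
      one_mem' := ⟨0, zero_mem _, fun f => by simp [wilsonLoop, evalChain_zero]⟩
      mul_mem' := by
        rintro g g' ⟨γ, hγ, h⟩ ⟨γ', hγ', h'⟩
        refine ⟨γ + γ', add_mem hγ hγ', fun f => ?_⟩
        rw [BoundedContinuousFunction.mul_apply, h, h', wilsonLoop, wilsonLoop, wilsonLoop,
          evalChain_add, AddChar.map_add_eq_mul] }
  refine tendsto_nhds_limUnder (exists_tendsto_probabilityMeasure _ M ?_ ?_ ?_)
  · rintro g ⟨γ, hγ, h⟩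
    refine ⟨-γ, neg_mem hγ, fun f => ?_⟩
    have hneg : evalChain (ZMod q) f (-γ) = -evalChain (ZMod q) f γ := by
      rw [eq_neg_iff_add_eq_zero, ← evalChain_add, neg_add_cancel, evalChain_zero]
    rw [BoundedContinuousFunction.star_apply, h, wilsonLoop, wilsonLoop, hneg,
      AddChar.map_neg_eq_conj]
    rfl
  · intro x y hxy
    obtain ⟨σ, hσ⟩ := Function.ne_iff.1 hxy
    refine ⟨BoundedContinuousFunction.mkOfCompact ⟨_, continuous_wilsonLoop (Finsupp.single σ.1 1)⟩,
      ⟨_, Finsupp.single_mem_supported _ _ ⟨trivial, σ.2⟩, fun ω => rfl⟩, fun h => hσ ?_⟩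
    have h' := ZMod.injective_stdAddChar h
    rwa [evalChain_single, evalChain_single, one_mul, one_mul] at h'
  · rintro g ⟨γ, hγ, h⟩
    simp only [h]
    exact ⟨_, tendsto_integral_wilsonLoop hi hp hγ⟩

end PottsLimit

end PlaquetteModel

theorem mainTheorem1 (d i q : ℕ) [Fact q.Prime] (hi : 0 < i) (hid : i + 1 < d)
    (β : ℝ) (hβ : 0 ≤ β) (p : unitInterval) (hp : (p : ℝ) = 1 - Real.exp (-β)) :
    Tendsto (fun n => PlaquetteModel.potts (PlaquetteModel.box d n) i q β) atTop
      (𝓝 (PlaquetteModel.pottsZd d i q β)) ∧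
    Tendsto (fun n => PlaquetteModel.randomCluster (PlaquetteModel.box d n) i q p) atTop
      (𝓝 (PlaquetteModel.randomClusterZd d i q p)) ∧
    ∀ γ ∈ PlaquetteModel.cycles (ZMod q) (Set.univ : Set (PlaquetteModel.Cube d)) (i - 1),
      Integrable (PlaquetteModel.wilsonLoop γ)
        (PlaquetteModel.pottsZd d i q β :
          Measure (PlaquetteModel.Plaquette d (i - 1) → ZMod q)) ∧
      MeasurableSet (PlaquetteModel.nullHomologous i γ) ∧
      ∫ f, PlaquetteModel.wilsonLoop γ f ∂(PlaquetteModel.pottsZd d i q β :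
          Measure (PlaquetteModel.Plaquette d (i - 1) → ZMod q)) =
        (((PlaquetteModel.randomClusterZd d i q p :
          Measure (PlaquetteModel.Plaquette d i → Bool)).real
            (PlaquetteModel.nullHomologous i γ) : ℝ) : ℂ) := by
  have hp1 : (p : ℝ) < 1 := by rw [hp]; linarith [Real.exp_pos (-β)]
  have hpotts := PlaquetteModel.tendsto_potts (q := q) d hi hp
  refine ⟨hpotts, PlaquetteModel.tendsto_randomCluster d hi hp1, fun γ hγ => ?_⟩
  let W := BoundedContinuousFunction.mkOfCompact
    ⟨_, PlaquetteModel.continuous_wilsonLoop (k := i - 1) γ⟩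
  refine ⟨W.integrable _, (PlaquetteModel.isOpen_nullHomologous hi γ).measurableSet, ?_⟩
  exact tendsto_nhds_unique
    ((ProbabilityMeasure.tendsto_iff_forall_integral_rclike_tendsto ℂ).1 hpotts W)
    (PlaquetteModel.tendsto_integral_wilsonLoop hi hp hγ.1)
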